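/- Let $(\mathbb F_n)_{n\ge 1}$ be any family of finite fields, of arbitrary characteristics, whose orders are bounded by a polynomial in $n$ (for instance a single finite field $\mathbb F_n=\mathbb F$). An algebraic algorithm of rank $t$ for $m\times m$ matrix multiplication over a field $\mathbb F$ consists of coefficients $\alpha_{kl\mu},\beta_{kl\mu},\lambda_{ij\mu}\in\mathbb F$ ($i,j,k,l\in\{1,\dots,m\}$, $\mu\in\{1,\dots,t\}$) such that for all $A,B\in\mathbb F^{m\times m}$ and all $i,j$ $$(AB)[i,j]=\sum_{\mu=1}^t\lambda_{ij\mu}\Big(\sum_{k,l}\alpha_{kl\mu}A[k,l]\Big)\Big(\sum_{k,l}\beta_{kl\mu}B[l,k]\Big).$$ Let $\omega$ denote the exponent of matrix multiplication over the family, i.e. the least real $\tau$ such that for every $\epsilon>0$ the product of two $m\times m$ matrices over $\mathbb F_n$ can be computed by an algebraic algorithm of rank $O(m^{\tau+\epsilon})$, with a constant independent of $n$ and $m$. (For a single field this is the usual exponent of matrix multiplication over that field.) In the congested clique model, $n$ nodes proceed in synchronous rounds; in each round every node sends to every node a message of $\beta\lceil\log_2(n+1)\rceil$ bits, possibly different for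 different receivers, where $\beta\ge1$ is a fixed integer. Local computation is unrestricted. Consider the inversion problem: for an invertible lower triangular matrix $A\in\mathbb F_n^{n\times n}$, each node $\ell\in\{1,\dots,n\}$ initially knows the row $A[\ell,*]$ and the column $A[*,\ell]$, and at the end must output the row $A^{-1}[\ell,*]$ and the column $A^{-1}[*,\ell]$. Then the deterministic round complexity of this problem is $O(n^{1-2/\omega})$, with the usual convention that an $o(1)$ in the exponent is ignored: for every $\epsilon>0$ there is a constant $C$ such that for every $n\ge1$ some deterministic protocol solves the problem for all invertible lower triangular $A\in\mathbb F_n^{n\times n}$ in at most $C\,n^{1-2/\omega+\epsilon}$ rounds. Moreover, for every real $\tau>2$ such that $m\times m$ matrices over $\mathbb F_n$ can be multiplied by algebraic algorithms of rank $O(m^{\tau})$ (with a constant independent of $n$ and $m$), the problem is solved deterministically in at most $C\,n^{1-2/\tau}$ rounds for all $n\ge1$, for some constant $C$ independent of $n$. -/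

import Mathlib

/-- There is an algebraic (bilinear) algorithm of rank `t` over `F` for the product of an `n × m`
matrix by an `m × n` matrix. -/
def HasAlgebraicMMAlgorithm (F : Type*) [Field F] (n m t : ℕ) : Prop :=
  ∃ (α β : Fin n → Fin m → Fin t → F) (lam : Fin n → Fin n → Fin t → F),
    ∀ (A : Matrix (Fin n) (Fin m) F) (B : Matrix (Fin m) (Fin n) F) (i j : Fin n),
      (A * B) i j = ∑ μ : Fin t, lam i j μ *
        (∑ k : Fin n, ∑ l : Fin m, α k l μ * A k l) *
        (∑ k : Fin n, ∑ l : Fin m, β k l μ * B l k)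

/-- Square matrices over the fields of the family `F` can be multiplied by algebraic algorithms of
rank `O(m ^ τ)`, where `m` is the size of the matrices. The constant does not depend on the member
of the family. For a constant family this is the usual notion over one field. -/
def SquareMMRankBigO (F : ℕ → Type*) [∀ n, Field (F n)] (τ : ℝ) : Prop :=
  ∃ K : ℝ, ∀ n : ℕ, 1 ≤ n → ∀ m : ℕ, 1 ≤ m →
    ∃ t : ℕ, (t : ℝ) ≤ K * (m : ℝ) ^ τ ∧ HasAlgebraicMMAlgorithm (F n) m m t

/-- The exponent `ω` of square matrix multiplication over the family `F`: the least `τ` such that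
`m × m` matrices can be multiplied with rank `O(m ^ (τ + ε))` for every `ε > 0`. -/
noncomputable def matMulExponent (F : ℕ → Type*) [∀ n, Field (F n)] : ℝ :=
  sInf {τ : ℝ | ∀ ε : ℝ, 0 < ε → SquareMMRankBigO F (τ + ε)}

/-- A deterministic protocol for `n` nodes that communicate over a clique in synchronous rounds.
In each round every node sends to every node a message of `b` bits, which may be different for
different receivers. Local memory and local computation are unrestricted. -/
structure CliqueProtocol.{u} (n b : ℕ) (In Out : Type u) where
  /-- local states -/
  State : Type u
  /-- the initial state of a node, computed from its own input -/
  init : Fin n → In → State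
  /-- `send v s w` is the message sent to `w` by the node `v` in state `s` -/
  send : Fin n → State → Fin n → (Fin b → Bool)
  /-- `recv v s msg` is the new state of the node `v` in state `s` after it has received the
  message `msg u` from each node `u` -/
  recv : Fin n → State → (Fin n → (Fin b → Bool)) → State
  /-- the output of a node, computed from its own state -/
  out : Fin n → State → Out

namespace CliqueProtocol

universe u

variable {n b : ℕ} {In Out : Type u}

/-- The states of the nodes after a number of rounds, when the node `v` has the input `x v`. -/
def stateAfter (P : CliqueProtocol n b In Out) (x : Fin n → In) : ℕ → Fin n → P.State
  | 0, v => P.init v (x v)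
  | r + 1, v => P.recv v (P.stateAfter x r v) (fun w => P.send w (P.stateAfter x r w) v)

/-- The output of each node after `r` rounds. -/
def outputAfter (P : CliqueProtocol n b In Out) (x : Fin n → In) (r : ℕ) (v : Fin n) : Out :=
  P.out v (P.stateAfter x r v)

end CliqueProtocol

/-- The number of bits of a message in the congested clique with `n` nodes: `β ⌈log₂ (n + 1)⌉`. -/
def messageBits (β n : ℕ) : ℕ := β * Nat.clog 2 (n + 1)

/-- The part of a distributed `n × n` matrix that belongs to the node `ℓ`:
its `ℓ`-th row and its `ℓ`-th column. -/
def nodeShare {F : Type*} {n : ℕ} (A : Matrix (Fin n) (Fin n) F) (ℓ : Fin n) :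
    (Fin n → F) × (Fin n → F) :=
  (fun j => A ℓ j, fun i => A i ℓ)

/-- The inversion problem over `F`, for the invertible `n × n` matrices in `D`, can be solved
deterministically in `r` rounds of the congested clique with `n` nodes: initially the node `ℓ` has
the `ℓ`-th row and column of `A`, at the end it has the `ℓ`-th row and column of `A⁻¹`. -/
def InversionSolvableInRounds {F : Type*} [Field F] (β n : ℕ)
    (D : Set (Matrix (Fin n) (Fin n) F)) (r : ℕ) : Prop :=
  ∃ P : CliqueProtocol n (messageBits β n)
      ((Fin n → F) × (Fin n → F)) ((Fin n → F) × (Fin n → F)),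
    ∀ A ∈ D, IsUnit A → ∀ ℓ : Fin n, P.outputAfter (nodeShare A) r ℓ = nodeShare A⁻¹ ℓ

/-- The lower triangular `n × n` matrices. -/
def lowerTriangularMatrices (F : Type*) [Field F] (n : ℕ) : Set (Matrix (Fin n) (Fin n) F) :=
  {A | ∀ i j : Fin n, i < j → A i j = 0}

/-! Write `A` in 2 × 2 blocks with diagonal blocks `A₁₁`, `A₂₂`. The lower left block of the inverse
is `-A₂₂⁻¹ A₂₁ A₁₁⁻¹`, so inverses of diagonal blocks of size `m` yield those of size `2m` by two
multiplications of block diagonal matrices (`lowerTriangular_inv_offDiagonal`). Starting from the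
diagonal entries, about `log₂ n` doublings invert `A`.

For blocks of size `M`, there are about `n / M` independent products, treated simultaneously in
`Knowledge.reach_blockMul`. Each block is a `d × d` matrix of `e × e` matrices with `d ≈ M^(1/τ)`
and `e ≈ M / d`. A bilinear algorithm for `d × d` matrices then needs `O(M)` products of `e × e`
matrices per block, hence `O(n)` in all. Each node gets `O(1)` of them and exchanges `O(e² + n)`
field elements. Since loads of `O(k n)` per node are routed in `O(k)` rounds
(`Knowledge.reach_route`), a level costs `O(M^(2 - 2/τ) / n + 1)` rounds. The sum over the levels is
geometric up to a logarithm, which is absorbed because `τ > 2` (`exists_sum_levels_le`).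

Communication is described by what each node can distinguish rather than by explicit states;
`Knowledge.Reach.exists_protocol` turns this back into a protocol. -/

/-! ### Knowledge of the nodes, and protocols -/

/-- What the nodes know about the global input in `Ω`: node `v` cannot distinguish the inputs that
are related by the `v`-th relation. -/
abbrev Knowledge (n : ℕ) (Ω : Type*) := Fin n → Setoid Ω

namespace Knowledge

variable {n : ℕ} {Ω : Type*}

/-- The node `v` knows the value of `g` at the global input. -/
def Knows (K : Knowledge n Ω) (v : Fin n) {X : Type*} (g : Ω → X) : Prop :=
  ∀ ⦃x y : Ω⦄, K v x y → g x = g y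

/-- The knowledge after the value of `val i` has been revealed to the node `dst i`, for all `i`. -/
@[reducible]
def learn (K : Knowledge n Ω) {I X : Type*} (dst : I → Fin n) (val : I → Ω → X) :
    Knowledge n Ω := fun v =>
  { r := fun x y => K v x y ∧ ∀ i, dst i = v → val i x = val i y
    iseqv :=
      { refl := fun x => ⟨(K v).refl x, fun _ _ => rfl⟩
        symm := fun h => ⟨(K v).symm h.1, fun i hi => (h.2 i hi).symm⟩
        trans := fun h h' => ⟨(K v).trans h.1 h'.1, fun i hi => (h.2 i hi).trans (h'.2 i hi)⟩ } }

/-- The knowledge of nodes each of which knows its own part of the input. -/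
@[reducible]
def initial {In : Type*} (input : Ω → Fin n → In) : Knowledge n Ω :=
  fun v => Setoid.ker fun x => input x v

theorem learn_le (K : Knowledge n Ω) {I X : Type*} (dst : I → Fin n) (val : I → Ω → X) :
    K.learn dst val ≤ K := fun _ _ _ h => h.1

theorem learn_knows (K : Knowledge n Ω) {I X : Type*} (dst : I → Fin n) (val : I → Ω → X)
    (i : I) : (K.learn dst val).Knows (dst i) (val i) := fun _ _ h => h.2 i rfl

theorem Knows.mono {K K' : Knowledge n Ω} (h : K' ≤ K) {v : Fin n} {X : Type*} {g : Ω → X}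
    (hg : K.Knows v g) : K'.Knows v g := fun _ _ hxy => hg (h v hxy)

theorem knows_const (K : Knowledge n Ω) (v : Fin n) {X : Type*} (a : X) :
    K.Knows v (fun _ : Ω => a) := fun _ _ _ => rfl

theorem Knows.comp {K : Knowledge n Ω} {v : Fin n} {X Y : Type*} {g : Ω → X}
    (hg : K.Knows v g) (φ : X → Y) : K.Knows v (fun x => φ (g x)) :=
  fun _ _ hxy => congrArg φ (hg hxy)

theorem Knows.mul {K : Knowledge n Ω} {v : Fin n} {F : Type*} [Mul F] {g g' : Ω → F}
    (hg : K.Knows v g) (hg' : K.Knows v g') : K.Knows v (fun x => g x * g' x) :=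
  fun _ _ hxy => congrArg₂ (· * ·) (hg hxy) (hg' hxy)

theorem Knows.sum {K : Knowledge n Ω} {v : Fin n} {F ι : Type*} [AddCommMonoid F]
    {s : Finset ι} {g : ι → Ω → F} (hg : ∀ i ∈ s, K.Knows v (g i)) :
    K.Knows v (fun x => ∑ i ∈ s, g i x) :=
  fun _ _ hxy => Finset.sum_congr rfl fun i hi => hg i hi hxy

/-- `Reach b r K K'`: nodes with the knowledge `K` can gain the knowledge `K'` in `r` rounds with
messages of `b` bits. -/
inductive Reach (b : ℕ) : ℕ → Knowledge n Ω → Knowledge n Ω → Prop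
  | refl (K : Knowledge n Ω) : Reach b 0 K K
  | step {r : ℕ} {K K' : Knowledge n Ω} (f : Fin n × Fin n → Ω → (Fin b → Bool)) :
      Reach b r K K' → (∀ p, K'.Knows p.1 (f p)) → Reach b (r + 1) K (K'.learn Prod.snd f)

variable {b : ℕ}

theorem Reach.le {r : ℕ} {K K' : Knowledge n Ω} (h : Reach b r K K') : K' ≤ K := by
  induction h with
  | refl => exact le_rfl
  | step f _ _ ih => exact (learn_le _ _ _).trans ih

theorem Reach.trans {r s : ℕ} {K K' K'' : Knowledge n Ω} (h : Reach b r K K')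
    (h' : Reach b s K' K'') : Reach b (r + s) K K'' := by
  induction h' with
  | refl => exact h
  | step f _ hf ih => exact .step f (ih h) hf

/-- The knowledge after `i` rounds in which the messages are given by `f`. -/
@[reducible]
def evolve (K : Knowledge n Ω) (f : ℕ → Fin n × Fin n → Ω → (Fin b → Bool)) :
    ℕ → Knowledge n Ω
  | 0 => K
  | i + 1 => (evolve K f i).learn Prod.snd (f i)

theorem evolve_congr (K : Knowledge n Ω) {f g : ℕ → Fin n × Fin n → Ω → (Fin b → Bool)} {r : ℕ}
    (h : ∀ i < r, f i = g i) : evolve K f r = evolve K g r := by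
  induction r with
  | zero => rfl
  | succ r ih =>
    simp only [evolve]
    rw [ih fun i hi => h i (hi.trans r.lt_succ_self), h r r.lt_succ_self]

theorem Reach.exists_messages {r : ℕ} {K K' : Knowledge n Ω} (h : Reach b r K K') :
    ∃ f : ℕ → Fin n × Fin n → Ω → (Fin b → Bool),
      (∀ i < r, ∀ p, (evolve K f i).Knows p.1 (f i p)) ∧ evolve K f r = K' := by
  induction h with
  | refl K => exact ⟨fun _ _ _ _ => false, fun i hi => absurd hi (Nat.not_lt_zero i), rfl⟩
  | @step r K K' g _ hg ih =>
    obtain ⟨f, hf, rfl⟩ := ih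
    have hlt : ∀ j ≤ r, evolve K (Function.update f r g) j = evolve K f j := fun j hj =>
      evolve_congr K fun i hi => Function.update_of_ne (by omega) _ _
    refine ⟨Function.update f r g, fun i hi p => ?_, ?_⟩
    · rw [hlt i (by omega)]
      rcases eq_or_ne i r with rfl | hne
      · simpa using hg p
      · simpa [Function.update_of_ne hne] using hf i (by omega) p
    · simp [evolve, hlt r le_rfl]

open Classical in
/-- Knowledge that can be reached from the inputs of the nodes is computed by a protocol. -/
theorem Reach.exists_protocol.{u} {n b r : ℕ} {Ω In Out : Type u} [Inhabited Out]
    {input : Ω → Fin n → In} {output : Ω → Fin n → Out} {K : Knowledge n Ω}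
    (h : Reach b r (initial input) K) (hout : ∀ v, K.Knows v (fun x => output x v)) :
    ∃ P : CliqueProtocol n b In Out, ∀ x v, P.outputAfter (input x) r v = output x v := by
  obtain ⟨f, hf, rfl⟩ := h.exists_messages
  -- A state is the round number with the set of inputs consistent with everything seen so far.
  -- Messages and outputs are evaluated at an arbitrary element of that set; the choice is harmless
  -- because the node knows the value. The empty set never occurs on actual inputs.
  let P : CliqueProtocol n b In Out :=
    { State := ULift.{u} ℕ × Set Ω
      init := fun v s => (⟨0⟩, {x | input x v = s})
      send := fun v s w => if h : s.2.Nonempty then f s.1.down (v, w) h.some else fun _ => false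
      recv := fun v s msg => (⟨s.1.down + 1⟩, {x | x ∈ s.2 ∧ ∀ u, f s.1.down (u, v) x = msg u})
      out := fun v s => if h : s.2.Nonempty then output h.some v else default }
  have key : ∀ x i, i ≤ r → ∀ v, P.stateAfter (input x) i v =
      (⟨i⟩, {y | evolve (initial input) f i v y x}) := by
    intro x i
    induction i with
    | zero => intro _ v; rfl
    | succ i ih =>
      intro hi v
      have ih := ih (by omega)
      have hsend : ∀ u, P.send u (P.stateAfter (input x) i u) v = f i (u, v) x := by
        intro u
        rw [ih u]
        have hne : {y | evolve (initial input) f i u y x}.Nonempty := ⟨x, (_ : Setoid Ω).refl x⟩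
        change (if h : _ then _ else _) = _
        rw [dif_pos hne]
        exact hf i (by omega) (u, v) hne.some_mem
      simp only [CliqueProtocol.stateAfter, hsend]
      rw [ih v]
      refine Prod.ext rfl (Set.ext fun y => ?_)
      change (_ ∧ _) ↔ (_ ∧ _)
      refine and_congr Iff.rfl ⟨fun h p hp => ?_, fun h u => h (u, v) rfl⟩
      obtain ⟨u, w⟩ := p
      obtain rfl : w = v := hp
      exact h u
  refine ⟨P, fun x v => ?_⟩
  rw [CliqueProtocol.outputAfter, key x r le_rfl v]
  have hne : {y | evolve (initial input) f r v y x}.Nonempty := ⟨x, (_ : Setoid Ω).refl x⟩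
  change (if h : _ then _ else _) = _
  rw [dif_pos hne]
  exact hout v hne.some_mem

theorem reach_slots (K : Knowledge n Ω) {q : ℕ} (g : Fin q → Fin n × Fin n → Ω → (Fin b → Bool))
    (hg : ∀ i p, K.Knows p.1 (g i p)) :
    ∃ K', Reach b q K K' ∧ ∀ i p, K'.Knows p.2 (g i p) := by
  induction q with
  | zero => exact ⟨K, .refl K, fun i => i.elim0⟩
  | succ q ih =>
    obtain ⟨K', hK', h⟩ := ih (fun i => g i.castSucc) fun i => hg i.castSucc
    refine ⟨K'.learn Prod.snd (g (Fin.last q)),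
      .step _ hK' fun p => (hg (Fin.last q) p).mono hK'.le, fun i p => ?_⟩
    induction i using Fin.lastCases with
    | last => exact learn_knows K' Prod.snd (g (Fin.last q)) p
    | cast i => exact (h i p).mono (learn_le _ _ _)

open Classical in
/-- Delivery of items over the direct links, when no two items share a slot of a link. -/
theorem reach_direct (K : Knowledge n Ω) {F I : Type*} {c q : ℕ}
    {code : F → Fin c → Fin b → Bool} (hcode : Function.Injective code)
    {src dst : I → Fin n} {slot : I → Fin q}
    (hinj : Function.Injective fun i => (src i, dst i, slot i)) {val : I → Ω → F}
    (hval : ∀ i, K.Knows (src i) (val i)) :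
    ∃ K', Reach b (q * c) K K' ∧ ∀ i, K'.Knows (dst i) (val i) := by
  -- Each slot takes `c` rounds, one for each piece of the code word. Injectivity of (source,
  -- target, slot) makes the chosen item the only one there; an idle slot carries a constant.
  let g : Fin q × Fin c → Fin n × Fin n → Ω → (Fin b → Bool) := fun j p x =>
    if h : ∃ i, (src i, dst i, slot i) = (p.1, p.2, j.1) then code (val h.choose x) j.2
    else fun _ => false
  obtain ⟨K', hK', h⟩ := K.reach_slots (fun i => g (finProdFinEquiv.symm i)) (by
    intro i p
    by_cases h : ∃ i', (src i', dst i', slot i') = (p.1, p.2, (finProdFinEquiv.symm i).1)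
    · have := h.choose_spec
      simp only [g, dif_pos h]
      have h1 : src h.choose = p.1 := congrArg Prod.fst this
      intro x y hxy
      exact congrArg (fun a => code a (finProdFinEquiv.symm i).2) (hval h.choose (by rwa [h1]))
    · simp only [g, dif_neg h]
      exact K.knows_const _ _)
  refine ⟨K', hK', fun i x y hxy => hcode (funext fun a => ?_)⟩
  have h1 := h (finProdFinEquiv (slot i, a)) (src i, dst i) hxy
  have h2 : ∃ i', (src i', dst i', slot i') = (src i, dst i, slot i) := ⟨i, rfl⟩
  have h3 : h2.choose = i := hinj h2.choose_spec
  simpa only [Equiv.symm_apply_apply, g, dif_pos h2, h3] using h1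

end Knowledge

/-! ### Edge colouring, load balancing and routing -/

/-- Greedy edge colouring of a bipartite multigraph. -/
theorem exists_edge_coloring {I V W X : Type*} [Fintype I] [DecidableEq I] [DecidableEq V]
    [DecidableEq W] [Fintype X] [DecidableEq X] {src : I → V} {dst : I → W} {k : ℕ}
    (hsrc : ∀ v, {i | src i = v}.toFinset.card ≤ k) (hdst : ∀ v, {i | dst i = v}.toFinset.card ≤ k)
    (hX : 2 * k ≤ Fintype.card X) :
    ∃ col : I → X, ∀ i j, (src i = src j ∨ dst i = dst j) → col i = col j → i = j := by
  rcases isEmpty_or_nonempty I with hI | ⟨⟨i₀⟩⟩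
  · exact ⟨hI.elim, fun i => hI.elim i⟩
  have hk : 0 < k := (Finset.card_pos.2 ⟨i₀, by simp⟩).trans_le (hsrc (src i₀))
  have : Nonempty X := Fintype.card_pos_iff.1 (by omega)
  suffices H : ∀ s : Finset I, ∃ col : I → X, ∀ i ∈ s, ∀ j ∈ s,
      (src i = src j ∨ dst i = dst j) → col i = col j → i = j by
    obtain ⟨col, h⟩ := H Finset.univ
    exact ⟨col, fun i j => h i (Finset.mem_univ i) j (Finset.mem_univ j)⟩
  intro s
  induction s using Finset.induction_on with
  | empty => exact ⟨fun _ => Classical.arbitrary X, by simp⟩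
  | insert a s ha ih =>
    obtain ⟨col, h⟩ := ih
    -- At most `2 * (k - 1)` other edges meet `a`, so one of the `2 * k` colours is free.
    let N := ({i | src i = src a}.toFinset.erase a ∪ {i | dst i = dst a}.toFinset.erase a)
    have hN : (N.image col).card < Fintype.card X := by
      have h1 : ({i | src i = src a}.toFinset.erase a).card < k :=
        (Finset.card_erase_lt_of_mem (by simp)).trans_le (hsrc _)
      have h2 : ({i | dst i = dst a}.toFinset.erase a).card < k :=
        (Finset.card_erase_lt_of_mem (by simp)).trans_le (hdst _)
      have h3 : N.card ≤ _ := Finset.card_union_le _ _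
      have h4 : (N.image col).card ≤ N.card := Finset.card_image_le
      omega
    obtain ⟨x, hx⟩ : ∃ x, x ∉ N.image col := by
      by_contra! hall
      rw [Finset.eq_univ_iff_forall.2 hall, Finset.card_univ] at hN
      exact lt_irrefl _ hN
    have hx' : ∀ j ∈ s, (src j = src a ∨ dst j = dst a) → col j ≠ x := by
      intro j hj hja hcol
      have hne : j ≠ a := fun h => ha (h ▸ hj)
      exact hx (Finset.mem_image.2 ⟨j, by simpa [N, hne] using hja, hcol⟩)
    have hup : ∀ j ∈ s, Function.update col a x j = col j := fun j hj =>
      Function.update_of_ne (ne_of_mem_of_not_mem hj ha) _ _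
    refine ⟨Function.update col a x, fun i hi j hj hij hc => ?_⟩
    rcases Finset.mem_insert.1 hi with hia | his <;> rcases Finset.mem_insert.1 hj with hja | hjs
    · rw [hia, hja]
    · subst hia
      rw [hup j hjs, Function.update_self] at hc
      exact absurd hc.symm (hx' j hjs (hij.imp Eq.symm Eq.symm))
    · subst hja
      rw [hup i his, Function.update_self] at hc
      exact absurd hc (hx' i his hij)
    · rw [hup i his, hup j hjs] at hc
      exact h i his j hjs hij hc

/-- Objects can be distributed evenly over `n` nodes. -/
theorem exists_balanced_map (J : Type*) [Fintype J] {n : ℕ} (hn : 0 < n) :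
    ∃ h : J → Fin n, ∀ v, {j | h j = v}.toFinset.card ≤ Fintype.card J / n + 1 := by
  let e := Fintype.equivFin J
  -- Round robin: within a residue class an object is determined by its quotient by `n`.
  refine ⟨fun j => ⟨e j % n, Nat.mod_lt _ hn⟩, fun v => ?_⟩
  rw [← Finset.card_range (Fintype.card J / n + 1)]
  refine Finset.card_le_card_of_injOn (fun j => (e j : ℕ) / n) (fun j _ => ?_) ?_
  · simpa [Nat.lt_succ_iff] using Nat.div_le_div_right (c := n) (e j).2.le
  · intro i hi j hj hij
    have h1 : (e i : ℕ) % n = v := by simpa [Fin.ext_iff] using hi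
    have h2 : (e j : ℕ) % n = v := by simpa [Fin.ext_iff] using hj
    have h3 : (e i : ℕ) / n = e j / n := hij
    apply e.injective
    rw [Fin.ext_iff, ← Nat.div_add_mod (e i : ℕ) n, ← Nat.div_add_mod (e j : ℕ) n, h1, h2, h3]

open Classical in
/-- Oblivious routing through intermediate nodes. -/
theorem Knowledge.reach_route {n b c k : ℕ} {Ω F I : Type*} [Fintype I] (K : Knowledge n Ω)
    {code : F → Fin c → Fin b → Bool} (hcode : Function.Injective code)
    {src dst : I → Fin n} (hsrc : ∀ v, {i | src i = v}.toFinset.card ≤ k * n)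
    (hdst : ∀ v, {i | dst i = v}.toFinset.card ≤ k * n) {val : I → Ω → F}
    (hval : ∀ i, K.Knows (src i) (val i)) :
    ∃ K', Reach b (4 * k * c) K K' ∧ ∀ i, K'.Knows (dst i) (val i) := by
  -- A colour is an intermediate node with a slot. Items of equal source have distinct colours, so
  -- the first hop has no collision; equal targets give the same for the second hop.
  obtain ⟨col, hcol⟩ := exists_edge_coloring (X := Fin n × Fin (2 * k)) hsrc hdst
    (by simp only [Fintype.card_prod, Fintype.card_fin]; apply le_of_eq; ring)
  obtain ⟨K₁, hK₁, h₁⟩ := K.reach_direct hcode (src := src) (dst := fun i => (col i).1)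
    (slot := fun i => (col i).2) (fun i j hij => by
      simp only [Prod.mk.injEq] at hij
      exact hcol i j (.inl hij.1) (Prod.ext hij.2.1 hij.2.2)) hval
  obtain ⟨K₂, hK₂, h₂⟩ := K₁.reach_direct hcode (src := fun i => (col i).1) (dst := dst)
    (slot := fun i => (col i).2) (fun i j hij => by
      simp only [Prod.mk.injEq] at hij
      exact hcol i j (.inr hij.2.1) (Prod.ext hij.1 hij.2.2)) h₁
  refine ⟨K₂, ?_, h₂⟩
  have := hK₁.trans hK₂
  rwa [← add_mul, show 2 * k + 2 * k = 4 * k by ring] at this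

/-- Bounds the load of a node by the number of objects assigned to it times the number of items per
object. -/
theorem card_fiber_comp_le {I J V : Type*} [Fintype I] [Fintype J] [DecidableEq J] [DecidableEq V]
    {f : I → J} {h : J → V} {a q : ℕ} (hf : ∀ j, {i | f i = j}.toFinset.card ≤ a)
    (hh : ∀ v, {j | h j = v}.toFinset.card ≤ q) (v : V) :
    {i | h (f i) = v}.toFinset.card ≤ a * q := by
  refine (Finset.card_le_mul_card_image_of_maps_to (f := f) (t := {j | h j = v}.toFinset)
    (fun i hi => by simpa using hi) a fun j _ => ?_).trans (Nat.mul_le_mul_left a (hh v))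
  refine (Finset.card_le_card fun i hi => ?_).trans (hf j)
  simpa using (Finset.mem_filter.1 hi).2

theorem card_fiber_le_of_injective {I J D : Type*} [Fintype I] [DecidableEq J] [Fintype D]
    {f : I → J} (g : I → D) (h : ∀ p q, f p = f q → g p = g q → p = q) (j : J) :
    {i | f i = j}.toFinset.card ≤ Fintype.card D := by
  rw [← Finset.card_univ]
  refine Finset.card_le_card_of_injOn g (by simp) fun p hp q hq => h p q ?_
  simp only [Set.coe_toFinset, Set.mem_ofPred_eq] at hp hq
  exact hp.trans hq.symm

/-! ### Distributed multiplication of block diagonal matrices -/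

/-- A bilinear algorithm for `d × d` matrices applied to block matrices. -/
theorem block_mul_apply {F : Type*} [Field F] {d e t : ℕ} {α β lam : Fin d → Fin d → Fin t → F}
    (h : ∀ (A B : Matrix (Fin d) (Fin d) F) (i j : Fin d),
      (A * B) i j = ∑ μ : Fin t, lam i j μ *
        (∑ k : Fin d, ∑ l : Fin d, α k l μ * A k l) * (∑ k : Fin d, ∑ l : Fin d, β k l μ * B l k))
    (S T : Fin d × Fin e → Fin d × Fin e → F) (i j : Fin d) (x y : Fin e) :
    ∑ p, S (i, x) p * T p (j, y) = ∑ μ : Fin t, lam i j μ * ∑ z : Fin e,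
      (∑ k : Fin d, ∑ l : Fin d, α k l μ * S (k, x) (l, z)) *
        (∑ k : Fin d, ∑ l : Fin d, β k l μ * T (l, z) (k, y)) := by
  rw [Fintype.sum_prod_type, Finset.sum_comm]
  have := fun z : Fin e => (Matrix.mul_apply ..).symm.trans
    (h (fun k l => S (k, x) (l, z)) (fun l k => T (l, z) (k, y)) i j)
  simp only [this, Finset.mul_sum (s := (Finset.univ : Finset (Fin e)))]
  rw [Finset.sum_comm]
  simp only [mul_assoc]

section Extend

variable {n : ℕ} {Q D F : Type*} {φ : Fin n → Q × D}

/-- The block of index `b` of a block diagonal matrix, padded with zeros. -/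
noncomputable def padBlock [Zero F] (φ : Fin n → Q × D) (S : Fin n → Fin n → F)
    (b : Q) (p q : D) : F :=
  Function.extend (fun z : Fin n × Fin n => (φ z.1, φ z.2)) (fun z => S z.1 z.2) 0
    ((b, p), (b, q))

theorem injective_prodMap_self {X Y : Type*} {φ : X → Y} (hφ : Function.Injective φ) :
    Function.Injective fun z : X × X => (φ z.1, φ z.2) := fun _ _ h =>
  Prod.ext (hφ (congrArg Prod.fst h)) (hφ (congrArg Prod.snd h))

theorem padBlock_apply [Zero F] (hφ : Function.Injective φ) (S : Fin n → Fin n → F)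
    {i j : Fin n} {b : Q} (hi : (φ i).1 = b) (hj : (φ j).1 = b) :
    padBlock φ S b (φ i).2 (φ j).2 = S i j := by
  have := (injective_prodMap_self hφ).extend_apply (fun z => S z.1 z.2) 0 (i, j)
  rw [padBlock, ← this]
  congr 2 <;> exact Prod.ext (by simp [hi, hj]) rfl

theorem padBlock_eq_zero [Zero F] (S : Fin n → Fin n → F) {b : Q} {p q : D}
    (h : ¬ ∃ i j, φ i = (b, p) ∧ φ j = (b, q)) : padBlock φ S b p q = 0 := by
  rw [padBlock, Function.extend_apply']
  · rfl
  · rintro ⟨⟨i, j⟩, hij⟩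
    exact h ⟨i, j, congrArg Prod.fst hij, congrArg Prod.snd hij⟩

theorem sum_padBlock_mul [Field F] [Fintype D] [DecidableEq Q]
    (hφ : Function.Injective φ) (S T : Fin n → Fin n → F) {i j : Fin n} (hij : (φ i).1 = (φ j).1) :
    ∑ p, padBlock φ S (φ i).1 (φ i).2 p * padBlock φ T (φ i).1 p (φ j).2 =
      ∑ l with (φ l).1 = (φ i).1, S i l * T l j := by
  symm
  refine Finset.sum_of_injOn (fun l => (φ l).2) ?_ (by simp) ?_ ?_
  · intro l hl l' hl' h
    simp only [Finset.coe_filter, Finset.mem_univ, true_and, Set.mem_ofPred_eq] at hl hl'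
    exact hφ (Prod.ext (hl.trans hl'.symm) h)
  · intro p _ hp
    rw [padBlock_eq_zero S, zero_mul]
    rintro ⟨_, l, -, hl⟩
    exact hp ⟨l, by simp [hl], by simp [hl]⟩
  · intro l hl
    simp only [Finset.mem_filter, Finset.mem_univ, true_and] at hl
    rw [padBlock_apply hφ S rfl hl, padBlock_apply hφ T hl hij.symm]

end Extend

open Classical in
/-- Distributed multiplication of block diagonal matrices. The position of the row `i` is `φ i`,
which consists of the index of its block, and of its coarse and fine positions in the block. -/
theorem Knowledge.reach_blockMul {n b c P d e t c₁ : ℕ} {Ω F : Type*} [Field F]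
    (K : Knowledge n Ω) (hn : 0 < n) {code : F → Fin c → Fin b → Bool}
    (hcode : Function.Injective code) (hmm : HasAlgebraicMMAlgorithm F d d t)
    (hPt : P * t ≤ c₁ * n) (hPd : P * (d * d) ≤ c₁ * n)
    {φ : Fin n → Fin P × Fin d × Fin e} (hφ : Function.Injective φ) {S T : Ω → Fin n → Fin n → F}
    (hS : ∀ i j, (φ i).1 = (φ j).1 → K.Knows i (fun ω => S ω i j))
    (hT : ∀ i j, (φ i).1 = (φ j).1 → K.Knows i (fun ω => T ω i j)) :
    ∃ K', Reach b (7 * (4 * ((c₁ + 1) * (e * e / n + 2)) * c)) K K' ∧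
      ∀ i j, (φ i).1 = (φ j).1 →
        K'.Knows i (fun ω => ∑ l with (φ l).1 = (φ i).1, S ω i l * T ω l j) ∧
        K'.Knows j (fun ω => ∑ l with (φ l).1 = (φ i).1, S ω i l * T ω l j) := by
  obtain ⟨α, β, lam, hmm⟩ := hmm
  set k := e * e / n + 1 with hk
  set κ := (c₁ + 1) * (e * e / n + 2)
  have hκ' : κ = (c₁ + 1) * (k + 1) := rfl
  have hP : 0 < P := (Nat.zero_le _).trans_lt (φ ⟨0, hn⟩).1.2
  have hek : e * e ≤ k * n := by
    rw [hk, mul_comm _ n]; exact (Nat.lt_mul_div_succ (e * e) hn).le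
  -- A host serves one pair of fine positions in one block, and so holds a `d × d` matrix. A worker
  -- serves one product `μ` of one block, and so multiplies two `e × e` matrices.
  obtain ⟨host, hhost⟩ := exists_balanced_map (Fin P × Fin e × Fin e) hn
  obtain ⟨worker, hworker⟩ := exists_balanced_map (Fin P × Fin t) hn
  simp only [Fintype.card_prod, Fintype.card_fin] at hhost hworker
  -- The load of a node whose host roles involve `a` items each: `a = d * d` in the exchange with
  -- the owners, `a = t` in that with the workers.
  have hload : ∀ a, P * a ≤ c₁ * n → a * (P * (e * e) / n + 1) ≤ κ * n := by
    intro a ha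
    have h1 : a * (P * (e * e) / n) ≤ c₁ * (e * e) := by
      refine (Nat.mul_div_le_mul_div_assoc _ _ _).trans ?_
      refine Nat.div_le_of_le_mul ?_
      calc a * (P * (e * e)) = (P * a) * (e * e) := by ring
        _ ≤ (c₁ * n) * (e * e) := Nat.mul_le_mul_right _ ha
        _ = n * (c₁ * (e * e)) := by ring
    have h2 : a ≤ c₁ * n := (Nat.le_mul_of_pos_left a hP).trans ha
    calc a * (P * (e * e) / n + 1) ≤ c₁ * (k * n) + c₁ * n := by
          rw [mul_add, mul_one]
          exact add_le_add (h1.trans (Nat.mul_le_mul_left _ hek)) h2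
      _ ≤ κ * n := by rw [hκ']; nlinarith [Nat.zero_le (k * n)]
  have hone : n ≤ κ * n := Nat.le_mul_of_pos_left n (by positivity)
  -- the items that are exchanged between the owners and the hosts
  let I := {p : Fin n × Fin n // (φ p.1).1 = (φ p.2).1}
  let pos : I → Fin P × Fin e × Fin e := fun p => ((φ p.1.1).1, (φ p.1.1).2.2, (φ p.1.2).2.2)
  have hrow : ∀ v, {p : I | p.1.1 = v}.toFinset.card ≤ κ * n := fun v =>
    (card_fiber_le_of_injective (fun p : I => p.1.2)
      (fun p q hpq h => Subtype.ext (Prod.ext hpq h)) v).trans (by simpa using hone)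
  have hcol : ∀ v, {p : I | p.1.2 = v}.toFinset.card ≤ κ * n := fun v =>
    (card_fiber_le_of_injective (fun p : I => p.1.1)
      (fun p q hpq h => Subtype.ext (Prod.ext h hpq)) v).trans (by simpa using hone)
  have hpos : ∀ v, {p : I | host (pos p) = v}.toFinset.card ≤ κ * n := by
    refine fun v => le_trans (card_fiber_comp_le (fun j => card_fiber_le_of_injective
      (fun p : I => ((φ p.1.1).2.1, (φ p.1.2).2.1)) (fun p q h0 h => ?_) j) hhost v) ?_
    · simp only [pos, Prod.mk.injEq] at h0 h
      exact Subtype.ext (Prod.ext (hφ (Prod.ext h0.1 (Prod.ext h.1 h0.2.1)))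
        (hφ (Prod.ext (p.2.symm.trans (h0.1.trans q.2)) (Prod.ext h.2 h0.2.2))))
    · simpa using hload _ hPd
  -- the items that are exchanged between the hosts and the workers
  let J := (Fin P × Fin e × Fin e) × Fin t
  have hhw : ∀ v, {p : J | host p.1 = v}.toFinset.card ≤ κ * n := by
    refine fun v => le_trans (card_fiber_comp_le (f := fun p : J => p.1)
      (fun j => card_fiber_le_of_injective (fun p : J => p.2)
        (fun p q h0 h => Prod.ext h0 h) j) hhost v) ?_
    simpa using hload _ hPt
  have hwh : ∀ v, {p : J | worker (p.1.1, p.2) = v}.toFinset.card ≤ κ * n := by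
    refine fun v => le_trans (card_fiber_comp_le (f := fun p : J => (p.1.1, p.2))
      (fun j => card_fiber_le_of_injective (fun p : J => p.1.2)
        (fun p q h0 h => ?_) j) hworker v) ?_
    · simp only [Prod.mk.injEq] at h0
      exact Prod.ext (Prod.ext h0.1 h) h0.2
    · have h1 : P * t / n ≤ c₁ := Nat.div_le_of_le_mul (by rwa [mul_comm n])
      calc _ = e * e * (P * t / n + 1) := by simp
        _ ≤ (k * n) * (c₁ + 1) := Nat.mul_le_mul hek (Nat.succ_le_succ h1)
        _ ≤ κ * n := by rw [hκ']; nlinarith [Nat.zero_le ((c₁ + 1) * n)]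
  -- the hosts collect the entries
  have hcollect : ∀ (K : Knowledge n Ω) (S : Ω → Fin n → Fin n → F),
      (∀ i j, (φ i).1 = (φ j).1 → K.Knows i (fun ω => S ω i j)) →
      ∃ K', Reach b (4 * κ * c) K K' ∧ ∀ a x y k l,
        K'.Knows (host (a, x, y)) (fun ω => padBlock φ (S ω) a (k, x) (l, y)) := by
    intro K S hS
    obtain ⟨K', hK', h⟩ := K.reach_route hcode (I := I) (k := κ) (src := fun p => p.1.1)
      (dst := fun p => host (pos p)) hrow hpos (val := fun p ω => S ω p.1.1 p.1.2)
      fun p => hS _ _ p.2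
    refine ⟨K', hK', fun a x y k l => ?_⟩
    by_cases hex : ∃ i j, φ i = (a, k, x) ∧ φ j = (a, l, y)
    · obtain ⟨i, j, hi, hj⟩ := hex
      have := h ⟨(i, j), by rw [hi, hj]⟩
      simp only [pos, hi, hj] at this
      convert this using 2 with ω
      have := padBlock_apply hφ (S ω) (b := a) (by rw [hi]) (by rw [hj])
      rwa [hi, hj] at this
    -- Padding entries vanish for every input, so they are known without communication.
    · simp only [padBlock_eq_zero _ hex]
      exact K'.knows_const _ _
  obtain ⟨K₁, hK₁, h₁⟩ := hcollect K S hS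
  obtain ⟨K₂, hK₂, h₂⟩ := hcollect K₁ T fun i j hij => (hT i j hij).mono hK₁.le
  replace h₁ := fun a x y k l => (h₁ a x y k l).mono hK₂.le
  -- the workers receive the linear combinations
  obtain ⟨K₃, hK₃, h₃⟩ := K₂.reach_route hcode (I := J) (k := κ)
    (src := fun p => host p.1) (dst := fun p => worker (p.1.1, p.2)) hhw hwh
    (val := fun p ω => ∑ k : Fin d, ∑ l : Fin d,
      α k l p.2 * padBlock φ (S ω) p.1.1 (k, p.1.2.1) (l, p.1.2.2))
    fun p => .sum fun k _ => .sum fun l _ => (K₂.knows_const _ _).mul (h₁ _ _ _ _ _)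
  obtain ⟨K₄, hK₄, h₄⟩ := K₃.reach_route hcode (I := J) (k := κ)
    (src := fun p => host p.1) (dst := fun p => worker (p.1.1, p.2)) hhw hwh
    (val := fun p ω => ∑ k : Fin d, ∑ l : Fin d,
      β k l p.2 * padBlock φ (T ω) p.1.1 (l, p.1.2.1) (k, p.1.2.2))
    fun p => .sum fun k _ => .sum fun l _ =>
      (K₃.knows_const _ _).mul ((h₂ _ _ _ _ _).mono hK₃.le)
  replace h₃ := fun p => (h₃ p).mono hK₄.le
  -- the hosts receive the products
  obtain ⟨K₅, hK₅, h₅⟩ := K₄.reach_route hcode (I := J) (k := κ)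
    (src := fun p => worker (p.1.1, p.2)) (dst := fun p => host p.1) hwh hhw
    (val := fun p ω => ∑ z : Fin e,
      (∑ k : Fin d, ∑ l : Fin d, α k l p.2 * padBlock φ (S ω) p.1.1 (k, p.1.2.1) (l, z)) *
      (∑ k : Fin d, ∑ l : Fin d, β k l p.2 * padBlock φ (T ω) p.1.1 (l, z) (k, p.1.2.2)))
    fun p => .sum fun z _ =>
      (h₃ ((p.1.1, p.1.2.1, z), p.2)).mul (h₄ ((p.1.1, z, p.1.2.2), p.2))
  have h₅' : ∀ p : I, K₅.Knows (host (pos p))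
      (fun ω => ∑ l with (φ l).1 = (φ p.1.1).1, S ω p.1.1 l * T ω l p.1.2) := by
    intro p
    -- The host combines the products with the coefficients `lam` locally.
    have := fun ω => (sum_padBlock_mul hφ (S ω) (T ω) p.2).symm.trans
      (block_mul_apply hmm (padBlock φ (S ω) (φ p.1.1).1) (padBlock φ (T ω) (φ p.1.1).1)
        (φ p.1.1).2.1 (φ p.1.2).2.1 (φ p.1.1).2.2 (φ p.1.2).2.2)
    simp only [this]
    exact .sum fun μ _ => (K₅.knows_const _ _).mul (h₅ (pos p, μ))
  obtain ⟨K₆, hK₆, h₆⟩ := K₅.reach_route hcode (I := I) (k := κ) (src := fun p => host (pos p))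
    (dst := fun p => p.1.1) hpos hrow h₅'
  obtain ⟨K₇, hK₇, h₇⟩ := K₆.reach_route hcode (I := I) (k := κ) (src := fun p => host (pos p))
    (dst := fun p => p.1.2) hpos hcol fun p => (h₅' p).mono hK₆.le
  refine ⟨K₇, ?_, fun i j hij => ⟨(h₆ ⟨(i, j), hij⟩).mono hK₇.le, h₇ ⟨(i, j), hij⟩⟩⟩
  have := hK₁.trans (hK₂.trans (hK₃.trans (hK₄.trans (hK₅.trans (hK₆.trans hK₇)))))
  convert this using 1
  ring

/-! ### Inverses of lower triangular matrices -/

section Triangular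

variable {F : Type*} [Field F] {n : ℕ}

theorem inv_mem_lowerTriangularMatrices {A : Matrix (Fin n) (Fin n) F}
    (hA : A ∈ lowerTriangularMatrices F n) (hu : IsUnit A) :
    A⁻¹ ∈ lowerTriangularMatrices F n := by
  have := hu.invertible
  have h : A.BlockTriangular OrderDual.toDual := fun i j hij => hA i j hij
  exact fun i j hij => Matrix.blockTriangular_inv_of_blockTriangular h hij

theorem inv_apply_self_of_lowerTriangular {A B : Matrix (Fin n) (Fin n) F}
    (hA : A ∈ lowerTriangularMatrices F n) (hB : B ∈ lowerTriangularMatrices F n)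
    (hBA : B * A = 1) (i : Fin n) : B i i = (A i i)⁻¹ := by
  refine eq_inv_of_mul_eq_one_left ?_
  have h := congrFun (congrFun hBA i) i
  rw [Matrix.mul_apply, Matrix.one_apply_eq, Finset.sum_eq_single i] at h
  · exact h
  · intro p _ hp
    rcases lt_or_gt_of_ne hp with hp | hp
    · rw [hA p i hp, mul_zero]
    · rw [hB i p hp, zero_mul]
  · simp

/-- The off-diagonal blocks of the inverse of a lower triangular matrix. The rows are grouped in
blocks by `c`, and the blocks of index `2a` and `2a + 1` form a larger block. -/
theorem lowerTriangular_inv_offDiagonal {A B : Matrix (Fin n) (Fin n) F}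
    (hA : A ∈ lowerTriangularMatrices F n) (hB : B ∈ lowerTriangularMatrices F n)
    (hAB : A * B = 1) (hBA : B * A = 1) {c : Fin n → ℕ} (hc : Monotone c) {i j : Fin n}
    (hij : c i / 2 = c j / 2) (hlt : c j < c i) :
    B i j = -∑ q with c q / 2 = c i / 2, (∑ p with c p / 2 = c i / 2,
      (if c i = c p then B i p else 0) * (if c q < c p then A p q else 0)) *
      (if c q = c j then B q j else 0) := by
  -- This is `A₂₁ B₁₁ = -A₂₂ B₂₁`, from the vanishing off-diagonal entries of `A * B`. Triangularity
  -- leaves only `j ≤ q ≤ p`, and `c j`, `c i` are consecutive, so `c q` is one of the two.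
  have hsplit : ∀ p, c p = c i → ∑ q, (if c q = c j then A p q * B q j else 0) =
      -∑ q, (if c q = c i then A p q * B q j else 0) := by
    intro p hp
    rw [eq_neg_iff_add_eq_zero, ← Finset.sum_add_distrib]
    have h := congrFun (congrFun hAB p) j
    rw [Matrix.mul_apply, Matrix.one_apply_ne (by rintro rfl; omega)] at h
    refine Eq.trans ?_ h
    refine Finset.sum_congr rfl fun q _ => ?_
    by_cases h1 : c q = c j
    · rw [if_pos h1, if_neg (by omega), add_zero]
    by_cases h2 : c q = c i
    · rw [if_neg h1, if_pos h2, zero_add]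
    rw [if_neg h1, if_neg h2, add_zero]
    rcases lt_or_ge p q with h3 | h3
    · rw [hA p q h3, zero_mul]
    rcases lt_or_ge q j with h4 | h4
    · rw [hB q j h4, mul_zero]
    · have := hc h3
      have := hc h4
      omega
  -- Likewise `B₂₂ A₂₂ = 1`: only `q ≤ p ≤ i` contributes to this entry of `B * A`.
  have hdelta : ∀ q, c q = c i → ∑ p, (if c p = c i then B i p * A p q else 0) =
      if i = q then 1 else 0 := by
    intro q hq
    rw [← Matrix.one_apply (n := Fin n), ← hBA, Matrix.mul_apply]
    refine Finset.sum_congr rfl fun p _ => ?_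
    split_ifs with h1
    · rfl
    rcases lt_or_ge i p with h3 | h3
    · rw [hB i p h3, zero_mul]
    rcases lt_or_ge p q with h4 | h4
    · rw [hA p q h4, mul_zero]
    · have := hc h3
      have := hc h4
      omega
  have h1 : ∑ q with c q / 2 = c i / 2, (∑ p with c p / 2 = c i / 2,
      (if c i = c p then B i p else 0) * (if c q < c p then A p q else 0)) *
      (if c q = c j then B q j else 0) =
      ∑ p, if c p = c i then B i p * ∑ q, (if c q = c j then A p q * B q j else 0) else 0 := by
    have hl : ∀ q, (if c q / 2 = c i / 2 then (∑ p with c p / 2 = c i / 2,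
        (if c i = c p then B i p else 0) * (if c q < c p then A p q else 0)) *
        (if c q = c j then B q j else 0) else 0) =
        ∑ p, if c p = c i then if c q = c j then B i p * (A p q * B q j) else 0 else 0 := by
      intro q
      split_ifs with h1 h2
      · rw [Finset.sum_mul, Finset.sum_filter]
        refine Finset.sum_congr rfl fun p _ => ?_
        by_cases h3 : c p = c i
        · rw [if_pos h3, if_pos h3.symm, if_pos (by omega), if_pos (by omega), mul_assoc]
        · rw [if_neg h3, if_neg (Ne.symm h3), zero_mul, zero_mul, ite_self]
      · simp
      · omega
      · simp
    rw [Finset.sum_filter, Finset.sum_congr rfl fun q _ => hl q, Finset.sum_comm]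
    refine Finset.sum_congr rfl fun p _ => ?_
    split_ifs with h
    · simp only [Finset.mul_sum, mul_ite, mul_zero]
    · exact Finset.sum_const_zero
  have h2 : ∑ p, (if c p = c i then B i p * ∑ q, (if c q = c i then A p q * B q j else 0) else 0)
      = ∑ q, if c q = c i then (∑ p, if c p = c i then B i p * A p q else 0) * B q j else 0 := by
    have hl : ∀ p, (if c p = c i then B i p * ∑ q, (if c q = c i then A p q * B q j else 0)
        else 0) = ∑ q, if c p = c i then if c q = c i then B i p * (A p q * B q j) else 0 else 0 := by
      intro p
      split_ifs
      · simp only [Finset.mul_sum, mul_ite, mul_zero]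
      · simp
    rw [Finset.sum_congr rfl fun p _ => hl p, Finset.sum_comm]
    refine Finset.sum_congr rfl fun q _ => ?_
    split_ifs with h
    · simp only [Finset.sum_mul, ite_mul, zero_mul, mul_assoc]
    · simp
  rw [h1, ← Finset.sum_neg_distrib]
  have h3 : ∀ p, -(if c p = c i then B i p * ∑ q, (if c q = c j then A p q * B q j else 0) else 0)
      = if c p = c i then B i p * ∑ q, (if c q = c i then A p q * B q j else 0) else 0 := by
    intro p
    split_ifs with hp
    · rw [hsplit p hp, mul_neg, neg_neg]
    · exact neg_zero
  simp only [h3]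
  rw [h2, Finset.sum_eq_single i]
  · rw [if_pos rfl, hdelta i rfl, if_pos rfl, one_mul]
  · intro q _ hq
    split_ifs with h
    · rw [hdelta q h, if_neg hq.symm, zero_mul]
    · rfl
  · simp

end Triangular

/-! ### Rank bounds, choice of block sizes, and the cost of the recursion -/

section Exponent

/-- Taking the identity as second factor writes every matrix as a fixed linear image of a vector in
`F ^ t`, so that linear map is onto. -/
theorem HasAlgebraicMMAlgorithm.mul_self_le {F : Type*} [Field F] {m t : ℕ}
    (h : HasAlgebraicMMAlgorithm F m m t) : m * m ≤ t := by
  obtain ⟨α, β, lam, h⟩ := h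
  let f : (Fin t → F) →ₗ[F] (Fin m × Fin m → F) :=
    LinearMap.pi fun p => ∑ μ, lam p.1 p.2 μ • LinearMap.proj μ
  have hf : Function.Surjective f := by
    intro A
    refine ⟨fun μ => (∑ k : Fin m, ∑ l : Fin m, α k l μ * A (k, l)) *
      (∑ k : Fin m, ∑ l : Fin m, β k l μ * (1 : Matrix (Fin m) (Fin m) F) l k),
      funext fun p => ?_⟩
    have := h (Matrix.of fun k l => A (k, l)) 1 p.1 p.2
    rw [mul_one] at this
    simp only [Matrix.of_apply] at this
    simp only [f, LinearMap.pi_apply, LinearMap.sum_apply, LinearMap.smul_apply,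
      LinearMap.proj_apply, smul_eq_mul]
    rw [show A p = A (p.1, p.2) from rfl, this]
    exact Finset.sum_congr rfl fun μ _ => by ring
  simpa using f.finrank_le_finrank_of_surjective hf

theorem hasAlgebraicMMAlgorithm_cube (F : Type*) [Field F] (m : ℕ) :
    HasAlgebraicMMAlgorithm F m m (m * m * m) := by
  let e : Fin (m * m * m) ≃ (Fin m × Fin m) × Fin m :=
    finProdFinEquiv.symm.trans (finProdFinEquiv.symm.prodCongr (Equiv.refl _))
  refine ⟨fun k l μ => if k = (e μ).1.1 then if l = (e μ).1.2 then 1 else 0 else 0,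
    fun k l μ => if k = (e μ).2 then if l = (e μ).1.2 then 1 else 0 else 0,
    fun i j μ => if (e μ).1.1 = i then if (e μ).2 = j then 1 else 0 else 0, fun A B i j => ?_⟩
  rw [← e.symm.sum_comp, Matrix.mul_apply]
  simp [Fintype.sum_prod_type]

theorem two_le_of_squareMMRankBigO {F : ℕ → Type*} [∀ n, Field (F n)] {σ : ℝ}
    (h : SquareMMRankBigO F σ) : 2 ≤ σ := by
  by_contra! hσ
  obtain ⟨K, hK⟩ := h
  have hle : ∀ m : ℕ, 1 ≤ m → (m : ℝ) ^ (2 - σ) ≤ K := by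
    intro m hm
    obtain ⟨t, ht, hmm⟩ := hK 1 le_rfl m hm
    have hm' : (0 : ℝ) < m := by exact_mod_cast hm
    have h1 : ((m * m : ℕ) : ℝ) ≤ t := by exact_mod_cast hmm.mul_self_le
    rw [Real.rpow_sub hm', div_le_iff₀ (Real.rpow_pos_of_pos hm' _)]
    refine le_trans (le_of_eq ?_) (h1.trans ht)
    rw [Real.rpow_two]
    push_cast
    ring
  have htend := (tendsto_rpow_atTop (sub_pos.2 hσ)).comp (tendsto_natCast_atTop_atTop (R := ℝ))
  obtain ⟨m, hm, hm1⟩ := ((htend.eventually_gt_atTop K).and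
    (Filter.eventually_ge_atTop 1)).exists
  exact absurd (hle m hm1) (not_le.2 hm)

theorem two_le_of_forall_squareMMRankBigO {F : ℕ → Type*} [∀ n, Field (F n)] {τ : ℝ}
    (h : ∀ ε : ℝ, 0 < ε → SquareMMRankBigO F (τ + ε)) : 2 ≤ τ :=
  le_of_forall_pos_le_add fun ε hε => two_le_of_squareMMRankBigO (h ε hε)

/-- The set defining `ω` is nonempty, so that its `sInf` is a genuine infimum. -/
theorem three_mem_exponents (F : ℕ → Type*) [∀ n, Field (F n)] :
    (3 : ℝ) ∈ {τ : ℝ | ∀ ε : ℝ, 0 < ε → SquareMMRankBigO F (τ + ε)} := by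
  refine fun ε hε => ⟨1, fun n _ m hm => ⟨m * m * m, ?_, hasAlgebraicMMAlgorithm_cube _ _⟩⟩
  have h1 : (1 : ℝ) ≤ m := by exact_mod_cast hm
  calc ((m * m * m : ℕ) : ℝ) = (m : ℝ) ^ (3 : ℝ) := by
        rw [show (3 : ℝ) = (3 : ℕ) by norm_num, Real.rpow_natCast]; push_cast; ring
    _ ≤ 1 * (m : ℝ) ^ (3 + ε) := by
        rw [one_mul]; exact Real.rpow_le_rpow_of_exponent_le h1 (by linarith)

theorem two_le_matMulExponent (F : ℕ → Type*) [∀ n, Field (F n)] : 2 ≤ matMulExponent F :=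
  le_csInf ⟨3, three_mem_exponents F⟩ fun _ hτ => two_le_of_forall_squareMMRankBigO hτ

theorem squareMMRankBigO_of_matMulExponent_lt {F : ℕ → Type*} [∀ n, Field (F n)] {σ : ℝ}
    (h : matMulExponent F < σ) : SquareMMRankBigO F σ := by
  obtain ⟨τ, hτ, hlt⟩ := exists_lt_of_csInf_lt ⟨3, three_mem_exponents F⟩ h
  simpa using hτ (σ - τ) (sub_pos.2 hlt)

/-- The sizes of the blocks and the numbers of instances for the multiplication of block diagonal
matrices with blocks of size `M` by `n` nodes. -/
theorem SquareMMRankBigO.exists_parameters {F : ℕ → Type*} [∀ n, Field (F n)] {τ : ℝ} (hτ : 2 < τ)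
    (h : SquareMMRankBigO F τ) :
    ∃ c₁ : ℕ, ∀ n M : ℕ, 1 ≤ n → 1 ≤ M → M ≤ 2 * n → ∃ P d e t : ℕ,
      HasAlgebraicMMAlgorithm (F n) d d t ∧ n ≤ P * M ∧ M ≤ d * e ∧ P * t ≤ c₁ * n ∧
      P * (d * d) ≤ c₁ * n ∧ ((e * e / n : ℕ) : ℝ) ≤ 9 * (M : ℝ) ^ (2 - 2 / τ) / n := by
  obtain ⟨K, hK⟩ := h
  refine ⟨3 * ⌈K⌉₊ + 3, fun n M hn hM hMn => ?_⟩
  have hM' : (1 : ℝ) ≤ M := by exact_mod_cast hM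
  have hM0 : (0 : ℝ) < M := by linarith
  have hn' : (0 : ℝ) < n := by exact_mod_cast hn
  have hroot : (1 : ℝ) ≤ (M : ℝ) ^ (1 / τ) := Real.one_le_rpow hM' (by positivity)
  -- The largest `d` with `d ^ τ ≤ M`, so that the rank is `O(M)` and all blocks together need
  -- `O(n)` products.
  set d := ⌊(M : ℝ) ^ (1 / τ)⌋₊ with hd
  have hd1 : 1 ≤ d := Nat.le_floor (by simpa using hroot)
  have hdle : (d : ℝ) ≤ (M : ℝ) ^ (1 / τ) := Nat.floor_le (by positivity)
  have hd1' : (1 : ℝ) ≤ d := by exact_mod_cast hd1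
  have hdge : (M : ℝ) ^ (1 / τ) ≤ 2 * d := by
    have := Nat.lt_floor_add_one ((M : ℝ) ^ (1 / τ))
    rw [← hd] at this
    linarith
  have hdpow : (d : ℝ) ^ τ ≤ M := by
    calc (d : ℝ) ^ τ ≤ ((M : ℝ) ^ (1 / τ)) ^ τ :=
          Real.rpow_le_rpow (by positivity) hdle (by linarith)
      _ = M := by
          rw [← Real.rpow_mul hM0.le, one_div_mul_cancel (by linarith), Real.rpow_one]
  obtain ⟨t, ht, hmm⟩ := hK n hn d hd1
  -- Rounding up the number of blocks costs at most `M ≤ 2 * n`.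
  have hPM : (n / M + 1) * M ≤ 3 * n := by
    have := Nat.div_mul_le_self n M
    rw [add_mul]
    omega
  have hscale : ∀ a k : ℕ, a ≤ k * M → (n / M + 1) * a ≤ (3 * k) * n := by
    intro a k ha
    calc (n / M + 1) * a ≤ (n / M + 1) * (k * M) := Nat.mul_le_mul_left _ ha
      _ = k * ((n / M + 1) * M) := by ring
      _ ≤ k * (3 * n) := Nat.mul_le_mul_left _ hPM
      _ = (3 * k) * n := by ring
  refine ⟨n / M + 1, d, M / d + 1, t, hmm, ?_, ?_, ?_, ?_, ?_⟩
  · have := Nat.lt_mul_div_succ n (show 0 < M from hM)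
    rw [mul_comm] at this
    exact this.le
  · exact (Nat.lt_mul_div_succ M (show 0 < d from hd1)).le
  · refine (hscale t ⌈K⌉₊ ?_).trans (Nat.mul_le_mul_right _ (by omega))
    have h1 : (t : ℝ) ≤ (⌈K⌉₊ : ℝ) * M :=
      ht.trans (mul_le_mul (Nat.le_ceil K) hdpow (by positivity) (by positivity))
    exact_mod_cast h1
  · refine (hscale (d * d) 1 ?_).trans (Nat.mul_le_mul_right _ (by omega))
    have h1 : ((d : ℝ) * d) ≤ M := by
      refine le_trans ?_ hdpow
      rw [← sq, ← Real.rpow_two]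
      exact Real.rpow_le_rpow_of_exponent_le hd1' hτ.le
    rw [one_mul]
    exact_mod_cast h1
  · have hx : (1 : ℝ) ≤ (M : ℝ) ^ (1 - 1 / τ) :=
      Real.one_le_rpow hM' (by rw [sub_nonneg, div_le_one] <;> linarith)
    have he : ((M / d + 1 : ℕ) : ℝ) ≤ 3 * (M : ℝ) ^ (1 - 1 / τ) := by
      have h1 : ((M / d : ℕ) : ℝ) ≤ (M : ℝ) / d := Nat.cast_div_le
      have h2 : (M : ℝ) / d ≤ 2 * (M : ℝ) ^ (1 - 1 / τ) := by
        rw [div_le_iff₀ (by linarith)]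
        calc (M : ℝ) = (M : ℝ) ^ (1 - 1 / τ) * (M : ℝ) ^ (1 / τ) := by
              rw [← Real.rpow_add hM0, sub_add_cancel, Real.rpow_one]
          _ ≤ (M : ℝ) ^ (1 - 1 / τ) * (2 * d) := by gcongr
          _ = 2 * (M : ℝ) ^ (1 - 1 / τ) * d := by ring
      push_cast
      linarith
    refine Nat.cast_div_le.trans ?_
    gcongr
    rw [Nat.cast_mul]
    calc ((M / d + 1 : ℕ) : ℝ) * ((M / d + 1 : ℕ) : ℝ)
        ≤ (3 * (M : ℝ) ^ (1 - 1 / τ)) * (3 * (M : ℝ) ^ (1 - 1 / τ)) := by gcongr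
      _ = 9 * ((M : ℝ) ^ (1 - 1 / τ) * (M : ℝ) ^ (1 - 1 / τ)) := by ring
      _ = 9 * (M : ℝ) ^ (2 - 2 / τ) := by
          rw [← Real.rpow_add hM0]
          congr 2
          ring

/-- The sum of the costs of the levels of the recursion. -/
theorem exists_sum_levels_le {a : ℝ} (ha : 1 < a) (ha2 : a ≤ 2) {C : ℝ} (hC : 0 ≤ C) :
    ∃ C' : ℝ, ∀ n : ℕ, 1 ≤ n →
      ∑ i ∈ Finset.range (Nat.clog 2 n), C * (9 * ((2 ^ (i + 1) : ℕ) : ℝ) ^ a / n + 2) ≤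
        C' * (n : ℝ) ^ (a - 1) := by
  -- `72 = 9 * 8` comes from the geometric sum `hsum`, and `4 / (a - 1)` from the bound `hlog` on
  -- the number of levels.
  refine ⟨C * (72 + 2 * (4 / (a - 1))), fun n hn => ?_⟩
  have hn1 : (1 : ℝ) ≤ n := by exact_mod_cast hn
  have hn0 : (0 : ℝ) < n := by linarith
  set L := Nat.clog 2 n
  have hL : 2 ^ L ≤ 2 * n := by
    rcases hL : L with _ | l
    · simp; omega
    · have : 2 ^ l < n := Nat.pow_lt_of_lt_clog (b := 2) (by omega)
      rw [pow_succ]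
      omega
  have hL' : (2 : ℝ) ^ L ≤ 2 * n := by exact_mod_cast hL
  set x := (2 : ℝ) ^ a with hx
  have hx2 : 2 ≤ x := by
    calc (2 : ℝ) = 2 ^ (1 : ℝ) := (Real.rpow_one 2).symm
      _ ≤ x := Real.rpow_le_rpow_of_exponent_le (by norm_num) ha.le
  have hpow : ∀ i : ℕ, ((2 ^ i : ℕ) : ℝ) ^ a = x ^ i := fun i => by
    rw [hx, ← Real.rpow_natCast, ← Real.rpow_mul (by norm_num), mul_comm, Real.rpow_mul
      (by norm_num), Real.rpow_natCast]
    push_cast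
    rfl
  have hgeom : ∀ l : ℕ, ∑ i ∈ Finset.range l, x ^ (i + 1) ≤ 2 * x ^ l := by
    intro l
    induction l with
    | zero => simp
    | succ l ih =>
      rw [Finset.sum_range_succ, pow_succ]
      nlinarith [pow_pos (show 0 < x by linarith) l]
  have hsum : ∑ i ∈ Finset.range L, x ^ (i + 1) ≤ 8 * (n : ℝ) ^ a := by
    refine (hgeom L).trans ?_
    rw [← hpow]
    calc 2 * ((2 ^ L : ℕ) : ℝ) ^ a ≤ 2 * (2 * (n : ℝ)) ^ a := by
          push_cast
          gcongr
      _ = 2 * (x * (n : ℝ) ^ a) := by rw [Real.mul_rpow (by norm_num) hn0.le]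
      _ ≤ 2 * (4 * (n : ℝ) ^ a) := by
          gcongr
          calc x ≤ 2 ^ (2 : ℝ) := Real.rpow_le_rpow_of_exponent_le (by norm_num) ha2
            _ = 4 := by norm_num
      _ = 8 * (n : ℝ) ^ a := by ring
  have hlog : (L : ℝ) ≤ 4 / (a - 1) * (n : ℝ) ^ (a - 1) := by
    have h1 : (L : ℝ) * Real.log 2 ≤ Real.log (2 * n) := by
      rw [← Real.log_pow]
      exact Real.log_le_log (by positivity) hL'
    have h2 : Real.log (2 * n) ≤ (2 * n : ℝ) ^ (a - 1) / (a - 1) :=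
      Real.log_le_rpow_div (by positivity) (by linarith)
    have h3 : (2 * n : ℝ) ^ (a - 1) ≤ 2 * (n : ℝ) ^ (a - 1) := by
      rw [Real.mul_rpow (by norm_num) hn0.le]
      gcongr
      calc (2 : ℝ) ^ (a - 1) ≤ 2 ^ (1 : ℝ) :=
            Real.rpow_le_rpow_of_exponent_le (by norm_num) (by linarith)
        _ = 2 := Real.rpow_one 2
    have h4 : (1 : ℝ) / 2 ≤ Real.log 2 := by linarith [Real.log_two_gt_d9]
    have h5 : (2 * n : ℝ) ^ (a - 1) / (a - 1) ≤ 2 * (n : ℝ) ^ (a - 1) / (a - 1) :=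
      div_le_div_of_nonneg_right h3 (by linarith)
    have h6 : 4 / (a - 1) * (n : ℝ) ^ (a - 1) = 2 * (2 * (n : ℝ) ^ (a - 1) / (a - 1)) := by ring
    rw [h6]
    nlinarith [Nat.cast_nonneg (α := ℝ) L]
  simp only [hpow]
  rw [← Finset.mul_sum, Finset.sum_add_distrib, ← Finset.sum_div, ← Finset.mul_sum,
    Finset.sum_const, Finset.card_range, nsmul_eq_mul, mul_assoc]
  gcongr
  have h7 : 9 * (∑ i ∈ Finset.range L, x ^ (i + 1)) / n ≤ 72 * (n : ℝ) ^ (a - 1) := by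
    rw [div_le_iff₀ hn0, mul_assoc 72, ← Real.rpow_add_one hn0.ne', sub_add_cancel]
    linarith
  linarith

end Exponent

/-! ### Encoding of field elements by messages -/

theorem Polynomial.exists_eval_le_pow (p : Polynomial ℕ) :
    ∃ c : ℕ, ∀ n : ℕ, 1 ≤ n → p.eval n ≤ (n + 1) ^ c := by
  -- `p.eval 1` is the sum of the coefficients. The base `n + 1 ≥ 2` lets a power absorb this
  -- constant even at `n = 1`.
  refine ⟨p.eval 1 + p.natDegree, fun n hn => ?_⟩
  have h1 : p.eval n ≤ p.eval 1 * n ^ p.natDegree := by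
    simp only [Polynomial.eval_eq_sum_range, one_pow, mul_one, Finset.sum_mul]
    exact Finset.sum_le_sum fun i hi => Nat.mul_le_mul_left _
      (Nat.pow_le_pow_right hn (Nat.lt_succ_iff.1 (Finset.mem_range.1 hi)))
  have h2 : p.eval 1 ≤ (n + 1) ^ p.eval 1 :=
    (Nat.lt_pow_self (show 1 < n + 1 by omega)).le
  rw [pow_add]
  exact h1.trans (Nat.mul_le_mul h2 (Nat.pow_le_pow_left n.le_succ _))

/-- The elements of fields of polynomial order are encoded by a constant number of messages. -/
theorem exists_code {F : ℕ → Type*} [∀ n, Finite (F n)]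
    (hF : ∃ p : Polynomial ℕ, ∀ n : ℕ, 1 ≤ n → Nat.card (F n) ≤ p.eval n) {β : ℕ} (hβ : 1 ≤ β) :
    ∃ c : ℕ, ∀ n : ℕ, 1 ≤ n →
      ∃ code : F n → Fin c → Fin (messageBits β n) → Bool, Function.Injective code := by
  obtain ⟨p, hp⟩ := hF
  obtain ⟨c, hc⟩ := p.exists_eval_le_pow
  refine ⟨c, fun n hn => ?_⟩
  have := Fintype.ofFinite (F n)
  have h : Fintype.card (F n) ≤ Fintype.card (Fin c → Fin (messageBits β n) → Bool) := by
    simp only [Fintype.card_fun, Fintype.card_fin, Fintype.card_bool]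
    rw [← Nat.card_eq_fintype_card]
    refine (hp n hn).trans ((hc n hn).trans (Nat.pow_le_pow_left ?_ c))
    refine (Nat.le_pow_clog one_lt_two (n + 1)).trans (Nat.pow_le_pow_right two_pos ?_)
    exact Nat.le_mul_of_pos_left _ hβ
  obtain ⟨f⟩ := Function.Embedding.nonempty_of_card_le h
  exact ⟨f, f.injective⟩

/-! ### The recursion on the diagonal blocks -/

namespace Knowledge

/-- Every node knows its entries of the diagonal blocks of size `m` of the inverse. -/
def KnowsInvBlocks {F : Type*} [Field F] {n : ℕ}
    {D : Set (Matrix (Fin n) (Fin n) F)} (K : Knowledge n D) (m : ℕ) : Prop :=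
  ∀ i j : Fin n, (i : ℕ) / m = j / m →
    K.Knows i (fun A => (A : Matrix (Fin n) (Fin n) F)⁻¹ i j) ∧
    K.Knows j (fun A => (A : Matrix (Fin n) (Fin n) F)⁻¹ i j)

variable {F : Type*} [Field F] {n : ℕ}

/-- Division with remainder by `M`, then of the remainder by `e`. -/
theorem injective_blockPosition {M d e P : ℕ} (hn : n ≤ P * M) (hM : 0 < M) (he : M ≤ d * e) :
    ∃ φ : Fin n → Fin P × Fin d × Fin e, Function.Injective φ ∧ ∀ i, ((φ i).1 : ℕ) = i / M := by
  have he0 : 0 < e := by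
    rcases Nat.eq_zero_or_pos e with rfl | h
    · omega
    · exact h
  refine ⟨fun i => (⟨i / M, Nat.div_lt_of_lt_mul (by rw [mul_comm]; omega)⟩,
    ⟨i % M / e, Nat.div_lt_of_lt_mul (by
      rw [mul_comm]; exact (Nat.mod_lt _ hM).trans_le he)⟩,
    ⟨i % M % e, Nat.mod_lt _ he0⟩), fun i j h => ?_, fun i => rfl⟩
  simp only [Prod.mk.injEq, Fin.mk.injEq] at h
  have h1 : (i : ℕ) % M = j % M := by
    rw [← Nat.div_add_mod ((i : ℕ) % M) e, ← Nat.div_add_mod ((j : ℕ) % M) e, h.2.1, h.2.2]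
  rw [Fin.ext_iff, ← Nat.div_add_mod (i : ℕ) M, ← Nat.div_add_mod (j : ℕ) M, h.1, h1]

/-- The diagonal blocks of twice the size are inverted by two multiplications. -/
theorem reach_invBlocks_double {b c P d e t c₁ m : ℕ} {D : Set (Matrix (Fin n) (Fin n) F)}
    (hD : ∀ A ∈ D, A ∈ lowerTriangularMatrices F n ∧ IsUnit A) (hn : 0 < n)
    {code : F → Fin c → Fin b → Bool} (hcode : Function.Injective code)
    (hmm : HasAlgebraicMMAlgorithm F d d t) (hPM : n ≤ P * (2 * m)) (hde : 2 * m ≤ d * e)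
    (hPt : P * t ≤ c₁ * n) (hPd : P * (d * d) ≤ c₁ * n) (hm : 0 < m) {K : Knowledge n D}
    (hA : ∀ i j, K.Knows i (fun A => (A : Matrix (Fin n) (Fin n) F) i j))
    (hK : K.KnowsInvBlocks m) :
    ∃ K', Reach b (2 * (7 * (4 * ((c₁ + 1) * (e * e / n + 2)) * c))) K K' ∧
      K'.KnowsInvBlocks (2 * m) := by
  obtain ⟨φ, hφ, hφ1⟩ := injective_blockPosition hPM (by omega) hde
  have hblk : ∀ i, ((φ i).1 : ℕ) = (i : ℕ) / m / 2 := fun i => by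
    rw [hφ1, Nat.div_div_eq_div_mul, mul_comm]
  have hblk' : ∀ i j, (φ i).1 = (φ j).1 ↔ (i : ℕ) / m / 2 = (j : ℕ) / m / 2 := fun i j => by
    rw [Fin.ext_iff, hblk, hblk]
  have hS : ∀ i j, (φ i).1 = (φ j).1 → K.Knows i (fun A : D =>
      if (i : ℕ) / m = j / m then (A : Matrix (Fin n) (Fin n) F)⁻¹ i j else 0) := by
    intro i j _
    split_ifs with h
    · exact (hK i j h).1
    · exact K.knows_const _ _
  have hT : ∀ i j, (φ i).1 = (φ j).1 → K.Knows i (fun A : D =>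
      if (j : ℕ) / m < i / m then (A : Matrix (Fin n) (Fin n) F) i j else 0) := by
    intro i j _
    split_ifs with h
    · exact hA i j
    · exact K.knows_const _ _
  -- `S` consists of the known inverse blocks, `T` of the blocks of `A` below them. In each block of
  -- size `2 * m` the first product has lower left part `B₂₂ A₂₁`, and multiplying by `S` again
  -- gives `B₂₂ A₂₁ B₁₁`.
  obtain ⟨K₁, hK₁, h₁⟩ := K.reach_blockMul hn hcode hmm hPt hPd hφ hS hT
  obtain ⟨K₂, hK₂, h₂⟩ := K₁.reach_blockMul hn hcode hmm hPt hPd hφ (fun i j hij => (h₁ i j hij).1)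
    fun i j hij => (hS i j hij).mono hK₁.le
  have hle : K₂ ≤ K := hK₂.le.trans hK₁.le
  refine ⟨K₂, by rw [two_mul]; exact hK₁.trans hK₂, fun i j hij => ?_⟩
  rw [mul_comm, ← Nat.div_div_eq_div_mul, ← Nat.div_div_eq_div_mul] at hij
  rcases lt_trichotomy ((i : ℕ) / m) (j / m) with h | h | h
  · have hz : ∀ A : D, (A : Matrix (Fin n) (Fin n) F)⁻¹ i j = 0 := fun A =>
      inv_mem_lowerTriangularMatrices (hD A A.2).1 (hD A A.2).2 i j
        (lt_of_not_ge fun hji => absurd (Nat.div_le_div_right (c := m) hji) (not_le.2 h))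
    simp only [hz]
    exact ⟨K₂.knows_const _ _, K₂.knows_const _ _⟩
  · exact ⟨(hK i j h).1.mono hle, (hK i j h).2.mono hle⟩
  · have hf : ∀ A : D, (A : Matrix (Fin n) (Fin n) F)⁻¹ i j = _ := fun A =>
      have hu := (Matrix.isUnit_iff_isUnit_det _).1 (hD A A.2).2
      lowerTriangular_inv_offDiagonal (hD A A.2).1
        (inv_mem_lowerTriangularMatrices (hD A A.2).1 (hD A A.2).2)
        (Matrix.mul_nonsing_inv _ hu) (Matrix.nonsing_inv_mul _ hu)
        (c := fun i : Fin n => (i : ℕ) / m) (fun x y hxy => Nat.div_le_div_right hxy) hij h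
    have h₃ := h₂ i j ((hblk' i j).2 hij)
    simp only [hblk'] at h₃
    simp only [hf]
    refine ⟨Knows.comp (K := K₂) ?_ Neg.neg, Knows.comp (K := K₂) ?_ Neg.neg⟩
    · convert h₃.1 using 2
    · convert h₃.2 using 2

end Knowledge

open Knowledge in
theorem inversionSolvable_of_squareMMRankBigO {F : ℕ → Type*} [∀ n, Field (F n)]
    [∀ n, Finite (F n)]
    (hF : ∃ p : Polynomial ℕ, ∀ n : ℕ, 1 ≤ n → Nat.card (F n) ≤ p.eval n)
    {β : ℕ} (hβ : 1 ≤ β) {τ : ℝ} (hτ : 2 < τ) (h : SquareMMRankBigO F τ) :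
    ∃ C : ℝ, ∀ n : ℕ, 1 ≤ n → ∃ r : ℕ, (r : ℝ) ≤ C * (n : ℝ) ^ (1 - 2 / τ) ∧
      InversionSolvableInRounds β n (lowerTriangularMatrices (F n) n) r := by
  obtain ⟨c, hc⟩ := exists_code hF hβ
  obtain ⟨c₁, hc₁⟩ := h.exists_parameters hτ
  have h2τ : 2 / τ < 1 := (div_lt_one (by linarith)).2 hτ
  have h2τ' : 0 < 2 / τ := by positivity
  obtain ⟨C, hC⟩ := exists_sum_levels_le (a := 2 - 2 / τ) (by linarith) (by linarith)
    (Nat.cast_nonneg (2 * (7 * (4 * (c₁ + 1) * c))))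
  refine ⟨C, fun n hn => ?_⟩
  obtain ⟨code, hcode⟩ := hc n hn
  -- Only admissible inputs are compared, so the identities for the inverse hold throughout the set
  -- on which knowledge is defined.
  let D : Set (Matrix (Fin n) (Fin n) (F n)) :=
    {A | A ∈ lowerTriangularMatrices (F n) n ∧ IsUnit A}
  let K₀ : Knowledge n D := initial fun A => nodeShare (A : Matrix (Fin n) (Fin n) (F n))
  have hA : ∀ i j, K₀.Knows i (fun A => (A : Matrix (Fin n) (Fin n) (F n)) i j) :=
    fun i j A B hAB => congrFun (congrArg Prod.fst hAB) j
  have hlevel : ∀ k ≤ Nat.clog 2 n, ∃ r K, Reach (messageBits β n) r K₀ K ∧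
      K.KnowsInvBlocks (2 ^ k) ∧ (r : ℝ) ≤ ∑ i ∈ Finset.range k,
        ((2 * (7 * (4 * (c₁ + 1) * c)) : ℕ) : ℝ) *
          (9 * ((2 ^ (i + 1) : ℕ) : ℝ) ^ (2 - 2 / τ) / n + 2) := by
    intro k
    induction k with
    | zero =>
      refine fun _ => ⟨0, K₀, .refl _, fun i j hij => ?_, by simp⟩
      -- Blocks of size one are inverted locally, from the diagonal entries.
      obtain rfl : i = j := Fin.ext (by simpa using hij)
      have hinv : ∀ A : D, (A : Matrix (Fin n) (Fin n) (F n))⁻¹ i i =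
          ((A : Matrix (Fin n) (Fin n) (F n)) i i)⁻¹ := fun A =>
        inv_apply_self_of_lowerTriangular A.2.1 (inv_mem_lowerTriangularMatrices A.2.1 A.2.2)
          (Matrix.nonsing_inv_mul _ ((Matrix.isUnit_iff_isUnit_det _).1 A.2.2)) i
      simp only [hinv]
      exact ⟨(hA i i).comp _, (hA i i).comp _⟩
    | succ k ih =>
      intro hk
      obtain ⟨r, K, hr, hK, hle⟩ := ih (by omega)
      have hkn : 2 ^ k < n := Nat.pow_lt_of_lt_clog (b := 2) (by omega)
      obtain ⟨P, d, e, t, hmm, hPM, hde, hPt, hPd, he⟩ := hc₁ n (2 ^ (k + 1)) hn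
        (Nat.one_le_two_pow) (by rw [pow_succ]; omega)
      rw [pow_succ'] at hPM hde
      obtain ⟨K', hK', hinv⟩ := reach_invBlocks_double (D := D) (fun A hA => hA) hn hcode hmm hPM
        hde hPt hPd (Nat.two_pow_pos k) (fun i j => (hA i j).mono hr.le) hK
      refine ⟨_, K', hr.trans hK', by rwa [pow_succ'], ?_⟩
      rw [Finset.sum_range_succ, Nat.cast_add]
      refine add_le_add hle ?_
      calc ((2 * (7 * (4 * ((c₁ + 1) * (e * e / n + 2)) * c)) : ℕ) : ℝ)
          = ((2 * (7 * (4 * (c₁ + 1) * c)) : ℕ) : ℝ) * (((e * e / n : ℕ) : ℝ) + 2) := by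
            push_cast; ring
        _ ≤ _ := by gcongr
  obtain ⟨r, K, hr, hK, hle⟩ := hlevel _ le_rfl
  refine ⟨r, hle.trans ((hC n hn).trans_eq (by congr 2; ring)), ?_⟩
  -- At the last level a single block contains all indices.
  have hzero : ∀ i : Fin n, (i : ℕ) / 2 ^ Nat.clog 2 n = 0 := fun i =>
    Nat.div_eq_of_lt (i.2.trans_le (Nat.le_pow_clog one_lt_two n))
  have : Inhabited (F n) := ⟨0⟩
  obtain ⟨Q, hQ⟩ := hr.exists_protocol
    (output := fun A : D => nodeShare (A : Matrix (Fin n) (Fin n) (F n))⁻¹) fun v A B hAB =>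
      Prod.ext (funext fun j => (hK v j (by rw [hzero, hzero])).1 hAB)
        (funext fun i => (hK i v (by rw [hzero, hzero])).2 hAB)
  exact ⟨Q, fun A hA hu ℓ => hQ ⟨A, hA, hu⟩ ℓ⟩

/-! ### The bound in terms of the exponent -/

theorem mainTheorem10 (F : ℕ → Type*) [∀ n, Field (F n)] [∀ n, Finite (F n)]
    (hF : ∃ p : Polynomial ℕ, ∀ n : ℕ, 1 ≤ n → Nat.card (F n) ≤ p.eval n)
    (β : ℕ) (hβ : 1 ≤ β) :
    (∀ ε : ℝ, 0 < ε → ∃ C : ℝ, ∀ n : ℕ, 1 ≤ n → ∃ r : ℕ,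
      (r : ℝ) ≤ C * (n : ℝ) ^ (1 - 2 / matMulExponent F + ε) ∧
        InversionSolvableInRounds β n (lowerTriangularMatrices (F n) n) r) ∧
    (∀ τ : ℝ, 2 < τ → SquareMMRankBigO F τ → ∃ C : ℝ, ∀ n : ℕ, 1 ≤ n → ∃ r : ℕ,
      (r : ℝ) ≤ C * (n : ℝ) ^ (1 - 2 / τ) ∧
        InversionSolvableInRounds β n (lowerTriangularMatrices (F n) n) r) := by
  refine ⟨fun ε hε => ?_, fun τ hτ h => inversionSolvable_of_squareMMRankBigO hF hβ hτ h⟩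
  have hω := two_le_matMulExponent F
  set ω := matMulExponent F
  -- As `ω ≥ 2`, the exponent `ω + ε` exceeds 2 even if `ω = 2`, and it is attained even if `ω` is
  -- not.
  obtain ⟨C, hC⟩ := inversionSolvable_of_squareMMRankBigO hF hβ (τ := ω + ε) (by linarith)
    (squareMMRankBigO_of_matMulExponent_lt (by linarith))
  -- A nonnegative constant is needed to enlarge the exponent of `n`.
  refine ⟨|C|, fun n hn => ?_⟩
  obtain ⟨r, hr, hsol⟩ := hC n hn
  refine ⟨r, hr.trans ?_, hsol⟩
  have hn1 : (1 : ℝ) ≤ n := by exact_mod_cast hn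
  have hexp : 1 - 2 / (ω + ε) ≤ 1 - 2 / ω + ε := by
    have h1 : 2 / ω - 2 / (ω + ε) = 2 * ε / (ω * (ω + ε)) := by
      have : ω ≠ 0 := by linarith
      have : ω + ε ≠ 0 := by linarith
      field_simp
      ring
    have h2 : 2 * ε / (ω * (ω + ε)) ≤ ε := by
      have h3 : 2 * 2 ≤ ω * (ω + ε) := mul_le_mul hω (by linarith) (by norm_num) (by linarith)
      rw [div_le_iff₀ (by linarith)]
      nlinarith
    linarith
  exact mul_le_mul (le_abs_self C) (Real.rpow_le_rpow_of_exponent_le hn1 hexp) (by positivity)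
    (abs_nonneg C)
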